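/- Let $D=(V,A)$ be a finite digraph (parallel edges and loops are allowed) and let $m:V\to\mathbf Z$ satisfy $\sum_{v\in V}m(v)=0$. A function $z:A\to\mathbf Z$ is an integral $m$-flow if for every node $v\in V$ the sum of $z$ over the edges entering $v$ minus the sum of $z$ over the edges leaving $v$ equals $m(v)$. Its square-sum is $\sum_{a\in A}z(a)^2$. For $\pi:V\to\mathbf Z_+=\{0,1,2,\dots\}$ let $\Delta_\pi(a)=\pi(v)-\pi(u)$ for every edge $a\in A$ from $u$ to $v$ (the tension, or potential-difference, of $\pi$). (1) If $D$ has a non-negative integral $m$-flow, then the minimum square-sum of a non-negative integral $m$-flow is equal to $$\max\Big\{\sum_{v\in V}m(v)\pi(v)-\sum_{a\in A}\Big\lfloor\frac{\max(\Delta_\pi(a),0)}{2}\Big\rfloor\Big\lceil\frac{\max(\Delta_\pi(a),0)}{2}\Big\rceil:\ \pi:V\to\mathbf Z_+\Big\}.$$ (2) If $D$ has an integral $m$-flow, then the minimum square-sum of an integral $m$-flow is equal to $$\max\Big\{\sum_{v\in V}m(v)\pi(v)-\sum_{a\in A}\Big\lfloor\frac{\Delta_\pi(a)}{2}\Big\rfloor\Big\lceil\frac{\Delta_\pi(a)}{2}\Big\rceil:\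 \pi:V\to\mathbf Z_+\Big\}.$$ In both parts the minimum and the maximum are attained. -/

import Mathlib

/-- A directed graph with node set `V` and edge set `A`: the edge `a` leaves `tail a` and enters
`head a`. Parallel edges and loops are allowed. -/
structure DirMultigraph (V A : Type*) where
  tail : A → V
  head : A → V

namespace DirMultigraph

/-- `ϱ_x(v)`: the sum of `x` over the edges entering `v`. -/
def inSum {V A : Type*} [Fintype A] [DecidableEq V] (D : DirMultigraph V A) (x : A → ℤ) (v : V) :
    ℤ :=
  ∑ a with D.head a = v, x a

/-- `δ_x(v)`: the sum of `x` over the edges leaving `v`. -/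
def outSum {V A : Type*} [Fintype A] [DecidableEq V] (D : DirMultigraph V A) (x : A → ℤ) (v : V) :
    ℤ :=
  ∑ a with D.tail a = v, x a

/-- `x` is an (integral) `m`-flow. -/
def IsFlow {V A : Type*} [Fintype A] [DecidableEq V] (D : DirMultigraph V A) (m : V → ℤ)
    (x : A → ℤ) : Prop :=
  ∀ v, D.inSum x v - D.outSum x v = m v

/-- The tension (potential-difference) `Δ_π` of an integral potential `π`. -/
def tension {V A : Type*} (D : DirMultigraph V A) (π : V → ℤ) (a : A) : ℤ :=
  π (D.head a) - π (D.tail a)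

end DirMultigraph

/-- The square-sum `∑ z(a)²`. -/
def squareSum {A : Type*} [Fintype A] (z : A → ℤ) : ℤ :=
  ∑ a, z a ^ 2

/-- `⌊w/2⌋⌈w/2⌉`: the scalar product of the componentwise rounded halves of an integral vector. -/
def halfProd {A : Type*} [Fintype A] (w : A → ℤ) : ℤ :=
  ∑ a, ⌊(w a : ℚ) / 2⌋ * ⌈(w a : ℚ) / 2⌉

/-! Summation by parts turns `∑ m π` into `∑ z Δ_π` for every flow `z`, so duality is checked edge
by edge. If `f` and `c` are the floor and ceiling of `w/2`, then `z² - z w + f c = (z - f)(z - c) ≥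
0`, with equality when `|w - 2z| ≤ 1`. For a minimal `z`, no simple closed residual walk has
negative cost, where a unit push costs `1 ± 2z`. A feasible potential for these costs has tension
within 1 of `2z`, hence attains equality. In the non-negative case backward residual edges exist
only where `z > 0`; where `z = 0`, tension at most 1 is enough. -/

/-- `l` is the edge list of a walk from `u` to `v`, where the edge `e` goes from `src e` to
`dst e`. -/
def IsWalkList {V E : Type*} (src dst : E → V) : V → List E → V → Prop
  | u, [], v => u = v
  | u, e :: l, v => src e = u ∧ IsWalkList src dst (dst e) l v

section Walks

variable {V E : Type*} {src dst : E → V}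

theorem isWalkList_append {u v : V} {l₁ l₂ : List E} :
    IsWalkList src dst u (l₁ ++ l₂) v ↔
      ∃ w, IsWalkList src dst u l₁ w ∧ IsWalkList src dst w l₂ v := by
  induction l₁ generalizing u with
  | nil => simp [IsWalkList]
  | cons e l ih => simp [IsWalkList, ih, and_assoc]

/-- A walk that leaves some node twice contains a shorter closed walk whose removal leaves a shorter
walk with the same end nodes. -/
theorem IsWalkList.exists_split {u v : V} {l : List E} (h : IsWalkList src dst u l v)
    (hl : ¬ (l.map src).Nodup) :
    ∃ (l₁ l₂ l₃ : List E) (w : V), l = l₁ ++ (l₂ ++ l₃) ∧ l₂ ≠ [] ∧ l₃ ≠ [] ∧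
      IsWalkList src dst w l₂ w ∧ IsWalkList src dst u (l₁ ++ l₃) v := by
  induction l generalizing u with
  | nil => simp at hl
  | cons e l ih =>
    obtain ⟨rfl, hw⟩ := h
    by_cases he : src e ∈ l.map src
    · obtain ⟨e', he', heq⟩ := List.mem_map.1 he
      obtain ⟨s, t, rfl⟩ := List.append_of_mem he'
      obtain ⟨w, hs, ht⟩ := isWalkList_append.1 hw
      have hwe : src e' = w := ht.1
      refine ⟨[], e :: s, e' :: t, src e, by simp, by simp, by simp, ⟨rfl, ?_⟩, ?_⟩
      · rwa [← heq, hwe]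
      · exact ⟨heq, ht.2⟩
    · have hl' : ¬ (l.map src).Nodup := fun hn => hl (by
        rw [List.map_cons, List.nodup_cons]; exact ⟨he, hn⟩)
      obtain ⟨l₁, l₂, l₃, w, rfl, h₂, h₃, hc, hr⟩ := ih hw hl'
      exact ⟨e :: l₁, l₂, l₃, w, rfl, h₂, h₃, hc, rfl, hr⟩

theorem IsWalkList.cost_nonneg_of_closed {c : E → ℤ}
    (hc : ∀ u l, IsWalkList src dst u l u → (l.map src).Nodup → 0 ≤ (l.map c).sum)
    {u : V} {l : List E} (h : IsWalkList src dst u l u) : 0 ≤ (l.map c).sum := by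
  induction hn : l.length using Nat.strong_induction_on generalizing u l with
  | _ n ih =>
    subst hn
    by_cases hl : (l.map src).Nodup
    · exact hc u l h hl
    · obtain ⟨l₁, l₂, l₃, w, rfl, h₂, h₃, hw, hr⟩ := h.exists_split hl
      have p₂ := List.length_pos_iff.2 h₂
      have p₃ := List.length_pos_iff.2 h₃
      have a := ih l₂.length (by simp only [List.length_append]; omega) hw rfl
      have b := ih (l₁ ++ l₃).length (by simp only [List.length_append]; omega) hr rfl
      simp only [List.map_append, List.sum_append] at b ⊢
      omega

/-- Cutting out closed subwalks never raises the cost, and a walk with distinct sources uses each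
edge at most once. The bound makes infima of walk costs exist. -/
theorem IsWalkList.neg_sum_abs_le_cost [Fintype E] {c : E → ℤ}
    (hc : ∀ u l, IsWalkList src dst u l u → (l.map src).Nodup → 0 ≤ (l.map c).sum)
    {u v : V} {l : List E} (h : IsWalkList src dst u l v) : -∑ e, |c e| ≤ (l.map c).sum := by
  classical
  induction hn : l.length using Nat.strong_induction_on generalizing l with
  | _ n ih =>
    subst hn
    by_cases hl : (l.map src).Nodup
    · rw [← List.sum_toFinset c hl.of_map]
      calc -∑ e, |c e| ≤ -∑ e ∈ l.toFinset, |c e| := by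
            gcongr
            exact Finset.subset_univ _
        _ ≤ ∑ e ∈ l.toFinset, c e := by
            rw [← Finset.sum_neg_distrib]
            exact Finset.sum_le_sum fun e _ => neg_abs_le (c e)
    · obtain ⟨l₁, l₂, l₃, w, rfl, h₂, h₃, hw, hr⟩ := h.exists_split hl
      have p₂ := List.length_pos_iff.2 h₂
      have a := hw.cost_nonneg_of_closed hc
      have b := ih (l₁ ++ l₃).length (by simp only [List.length_append]; omega) hr rfl
      simp only [List.map_append, List.sum_append] at b ⊢
      omega

/-- A finite digraph without simple closed walks of negative cost has a feasible potential. -/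
theorem exists_potential_of_simple_closed_nonneg [Fintype E] {c : E → ℤ}
    (hc : ∀ u l, IsWalkList src dst u l u → (l.map src).Nodup → 0 ≤ (l.map c).sum) :
    ∃ π : V → ℤ, ∀ e, π (dst e) ≤ π (src e) + c e := by
  -- Walks may start anywhere, so the empty walk makes every set nonempty and no root is needed.
  let S : V → Set ℤ := fun v => {t | ∃ u l, IsWalkList src dst u l v ∧ t = (l.map c).sum}
  have hne : ∀ v, (S v).Nonempty := fun v => ⟨0, v, [], rfl, rfl⟩
  have hbd : ∀ v, BddBelow (S v) := by
    rintro v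
    refine ⟨-∑ e, |c e|, ?_⟩
    rintro t ⟨u, l, h, rfl⟩
    exact h.neg_sum_abs_le_cost hc
  refine ⟨fun v => sInf (S v), fun e => ?_⟩
  obtain ⟨u, l, h, ht⟩ := Int.csInf_mem (hne (src e)) (hbd (src e))
  refine csInf_le (hbd _) ⟨u, l ++ [e], isWalkList_append.2 ⟨_, h, rfl, rfl⟩, ?_⟩
  simp [ht]

end Walks

/-! ### Flows and the residual graph -/

namespace DirMultigraph

variable {V A : Type*} [Fintype A] (D : DirMultigraph V A)

section Flow

variable [DecidableEq V]

theorem IsFlow.sum_mul_tension [Fintype V] {D : DirMultigraph V A} {m : V → ℤ} {z : A → ℤ}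
    (h : D.IsFlow m z) (π : V → ℤ) : ∑ a, z a * D.tension π a = ∑ v, m v * π v := by
  have key : ∀ f : A → V, ∑ v, (∑ a with f a = v, z a) * π v = ∑ a, z a * π (f a) := by
    intro f
    rw [← Finset.sum_fiberwise (s := Finset.univ) (g := f)]
    refine Finset.sum_congr rfl fun v _ => ?_
    rw [Finset.sum_mul]
    refine Finset.sum_congr rfl fun a ha => ?_
    rw [(Finset.mem_filter.1 ha).2]
  simp only [← h _, inSum, outSum, sub_mul, Finset.sum_sub_distrib, key, tension, mul_sub]

theorem IsFlow.add {D : DirMultigraph V A} {m m' : V → ℤ} {x y : A → ℤ} (hx : D.IsFlow m x)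
    (hy : D.IsFlow m' y) : D.IsFlow (m + m') (x + y) := by
  intro v
  rw [Pi.add_apply, ← hx v, ← hy v]
  simp only [inSum, outSum, Pi.add_apply, Finset.sum_add_distrib]
  ring

end Flow

/-- The start node of a residual edge: `(a, true)` runs along `a` and `(a, false)` against it. -/
def residualSrc (e : A × Bool) : V := if e.2 then D.tail e.1 else D.head e.1

/-- The end node of a residual edge. -/
def residualDst (e : A × Bool) : V := if e.2 then D.head e.1 else D.tail e.1

/-- The change of the flow caused by pushing one unit along a residual edge. -/
def unitPush [DecidableEq A] (e : A × Bool) : A → ℤ := Pi.single e.1 (if e.2 then 1 else -1)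

theorem isFlow_unitPush [DecidableEq V] [DecidableEq A] (e : A × Bool) :
    D.IsFlow (Pi.single (D.residualDst e) 1 - Pi.single (D.residualSrc e) 1) (unitPush e) := by
  obtain ⟨a, b⟩ := e
  intro v
  simp only [inSum, outSum, unitPush, Finset.sum_filter, Pi.single_apply, Pi.sub_apply,
    residualDst, residualSrc]
  have key : ∀ (f : A → V) (t : ℤ),
      (∑ x, if f x = v then (if x = a then t else 0) else 0) = if v = f a then t else 0 := by
    intro f t
    rw [Finset.sum_eq_single a]
    · simp [eq_comm]
    · intro x _ hx
      simp [hx]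
    · simp
  rw [key, key]
  cases b <;> simp only [Bool.false_eq_true, if_true, if_false] <;> split_ifs <;> rfl

theorem isFlow_sum_unitPush [DecidableEq V] [DecidableEq A] {u v : V} {l : List (A × Bool)}
    (h : IsWalkList D.residualSrc D.residualDst u l v) :
    D.IsFlow (Pi.single v 1 - Pi.single u 1) (l.map unitPush).sum := by
  induction l generalizing u with
  | nil =>
    obtain rfl : u = v := h
    intro w
    simp [inSum, outSum]
  | cons e l ih =>
    obtain ⟨rfl, hl⟩ := h
    have := (D.isFlow_unitPush e).add (ih hl)
    simpa [sub_add_sub_cancel'] using this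

theorem sum_unitPush_apply [DecidableEq A] {l : List (A × Bool)} (hl : l.Nodup) (a : A) :
    (l.map unitPush).sum a = (if (a, true) ∈ l then 1 else 0) - (if (a, false) ∈ l then 1 else 0) := by
  have : ∀ s : Finset (A × Bool), ∑ e ∈ s, unitPush e a =
      ∑ e : A × Bool, if e ∈ s then unitPush e a else 0 := fun s => by simp
  rw [← List.sum_toFinset _ hl, Finset.sum_apply, this, Fintype.sum_prod_type,
    Finset.sum_eq_single a]
  · simp only [Fintype.sum_bool, List.mem_toFinset, unitPush, Pi.single_eq_same]
    split_ifs <;> simp_all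
  · intro x _ hx
    simp [unitPush, hx.symm]
  · simp

/-- The increase of the square-sum caused by pushing one unit along a residual edge. -/
def residualCost (z : A → ℤ) (e : A × Bool) : ℤ := if e.2 then 2 * z e.1 + 1 else 1 - 2 * z e.1

/-- Only an inequality: if `l` uses both directions of an edge, the pushes cancel while their costs
add up to 2. -/
theorem squareSum_add_sum_unitPush_le [DecidableEq A] (z : A → ℤ) {l : List (A × Bool)}
    (hl : l.Nodup) :
    squareSum (z + (l.map unitPush).sum) ≤ squareSum z + (l.map (residualCost z)).sum := by
  rw [← List.sum_toFinset (residualCost z) hl]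
  have : ∑ e ∈ l.toFinset, residualCost z e =
      ∑ e : A × Bool, if e ∈ l then residualCost z e else 0 := by
    rw [← Finset.sum_filter]
    congr 1
    ext e
    simp
  rw [this, Fintype.sum_prod_type, squareSum, squareSum, ← Finset.sum_add_distrib]
  refine Finset.sum_le_sum fun a _ => ?_
  rw [Pi.add_apply, sum_unitPush_apply hl, Fintype.sum_bool]
  simp only [residualCost, Bool.false_eq_true, if_true, if_false]
  split_ifs <;> nlinarith

/-- A flow `z` of smallest square-sum admits a potential whose tension lies between `2z - 1` and
`2z + 1`; the lower bound holds on the edges in `R`, those on which `z` may be decreased. -/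
theorem exists_potential_of_squareSum_minimal [DecidableEq V] [Fintype V] {m : V → ℤ} {z : A → ℤ}
    (hz : D.IsFlow m z) (R : A → Prop)
    (hmin : ∀ z', D.IsFlow m z' → (∀ a, z a - 1 ≤ z' a) → (∀ a, ¬ R a → z a ≤ z' a) →
      squareSum z ≤ squareSum z') :
    ∃ π : V → ℤ, (∀ v, 0 ≤ π v) ∧ ∀ a, D.tension π a ≤ 2 * z a + 1 ∧
      (R a → 2 * z a - 1 ≤ D.tension π a) := by
  classical
  let E := {e : A × Bool // e.2 = true ∨ R e.1}
  obtain ⟨π, hπ⟩ := exists_potential_of_simple_closed_nonneg (E := E)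
    (src := fun e => D.residualSrc e.1) (dst := fun e => D.residualDst e.1)
    (c := fun e => residualCost z e.1) (by
      intro u l hw hn
      have hw' : IsWalkList D.residualSrc D.residualDst u (l.map Subtype.val) u := by
        have aux : ∀ (l : List E) (u v : V), IsWalkList (fun e : E => D.residualSrc e.1)
            (fun e => D.residualDst e.1) u l v →
            IsWalkList D.residualSrc D.residualDst u (l.map Subtype.val) v := by
          intro l
          induction l with
          | nil => exact fun _ _ h => h
          | cons e l ih => exact fun _ _ h => ⟨h.1, ih _ _ h.2⟩
        exact aux l u u hw
      -- Distinct sources force distinct edges, so the push changes each `z a` by at most 1.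
      have hn' : (l.map Subtype.val).Nodup := hn.of_map.map Subtype.val_injective
      have hflow := hz.add (D.isFlow_sum_unitPush hw')
      rw [sub_self, add_zero] at hflow
      have hle := hmin _ hflow
        (fun a => by
          rw [Pi.add_apply, sum_unitPush_apply hn']
          split_ifs <;> omega)
        (fun a ha => by
          have : (a, false) ∉ l.map Subtype.val := by
            intro hmem
            obtain ⟨e, -, he⟩ := List.mem_map.1 hmem
            have := e.2
            rw [he] at this
            simp [ha] at this
          rw [Pi.add_apply, sum_unitPush_apply hn', if_neg this]
          split_ifs <;> omega)
      have := squareSum_add_sum_unitPush_le z hn'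
      rw [List.map_map (f := Subtype.val) (g := residualCost z)] at this
      change 0 ≤ (l.map (residualCost z ∘ Subtype.val)).sum
      omega)
  -- A constant shift makes the potential non-negative and preserves its tension.
  refine ⟨fun v => π v + ∑ w, |π w|, fun v => ?_, fun a => ⟨?_, fun ha => ?_⟩⟩
  · have := Finset.single_le_sum (fun w _ => abs_nonneg (π w)) (Finset.mem_univ v)
    have := neg_abs_le (π v)
    change 0 ≤ π v + ∑ w, |π w|
    linarith
  · have := hπ ⟨(a, true), Or.inl rfl⟩
    simp only [residualSrc, residualDst, residualCost, if_true] at this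
    simp only [tension]
    omega
  · have := hπ ⟨(a, false), Or.inr ha⟩
    simp only [residualSrc, residualDst, residualCost, Bool.false_eq_true, if_false] at this
    simp only [tension]
    omega

end DirMultigraph

/-! ### Edgewise inequality and the duality theorem -/

theorem floor_half_mul_ceil_half (w : ℤ) :
    ⌊(w : ℚ) / 2⌋ * ⌈(w : ℚ) / 2⌉ = (w / 2) * (w - w / 2) := by
  have h₁ : ⌊(w : ℚ) / 2⌋ = w / 2 := by
    have := Rat.floor_intCast_div_natCast w 2
    simpa using this
  have h₂ : ⌈(w : ℚ) / 2⌉ = w - w / 2 := by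
    have := Rat.ceil_intCast_div_natCast w 2
    simp at this
    omega
  rw [h₁, h₂]

/-- No integer `z` lies strictly between the floor and the ceiling of `w/2`. -/
theorem mul_sub_half_mul_half_le_sq (z w : ℤ) : z * w - (w / 2) * (w - w / 2) ≤ z ^ 2 := by
  rcases Int.even_or_odd' w with ⟨k, rfl | rfl⟩
  · rw [show 2 * k / 2 = k by omega]
    nlinarith [sq_nonneg (z - k)]
  · rw [show (2 * k + 1) / 2 = k by omega]
    rcases le_or_gt z k with h | h <;> nlinarith

theorem mul_sub_half_mul_half_eq_sq {z w : ℤ} (h₁ : w ≤ 2 * z + 1) (h₂ : 2 * z - 1 ≤ w) :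
    z * w - (w / 2) * (w - w / 2) = z ^ 2 := by
  obtain rfl | rfl | rfl : w = 2 * z - 1 ∨ w = 2 * z ∨ w = 2 * z + 1 := by omega
  · rw [show (2 * z - 1) / 2 = z - 1 by omega]; ring
  · rw [show 2 * z / 2 = z by omega]; ring
  · rw [show (2 * z + 1) / 2 = z by omega]; ring

theorem exists_squareSum_minimal {A : Type*} [Fintype A] {P : (A → ℤ) → Prop} (h : ∃ z, P z) :
    ∃ z, P z ∧ ∀ z', P z' → squareSum z ≤ squareSum z' := by
  have hnn : ∀ z : A → ℤ, 0 ≤ squareSum z := fun z => Finset.sum_nonneg fun a _ => sq_nonneg _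
  obtain ⟨z, hz, hmin⟩ := (measure fun z : A → ℤ => (squareSum z).toNat).wf.has_min {z | P z} h
  refine ⟨z, hz, fun z' hz' => ?_⟩
  have : ¬ (squareSum z').toNat < (squareSum z).toNat := hmin z' hz'
  have := hnn z'
  omega

theorem theorem5p2 {V A : Type*} [Fintype V] [DecidableEq V] [Fintype A]
    (D : DirMultigraph V A) (m : V → ℤ) (hm : ∑ v, m v = 0) :
    ((∃ z : A → ℤ, (∀ a, 0 ≤ z a) ∧ D.IsFlow m z) →
      ∃ k : ℤ,
        IsLeast {s : ℤ | ∃ z : A → ℤ, (∀ a, 0 ≤ z a) ∧ D.IsFlow m z ∧ s = squareSum z} k ∧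
        IsGreatest {t : ℤ | ∃ π : V → ℤ, (∀ v, 0 ≤ π v) ∧
          t = ∑ v, m v * π v - halfProd (fun a => max (D.tension π a) 0)} k) ∧
    ((∃ z : A → ℤ, D.IsFlow m z) →
      ∃ k : ℤ,
        IsLeast {s : ℤ | ∃ z : A → ℤ, D.IsFlow m z ∧ s = squareSum z} k ∧
        IsGreatest {t : ℤ | ∃ π : V → ℤ, (∀ v, 0 ≤ π v) ∧
          t = ∑ v, m v * π v - halfProd (D.tension π)} k) := by
  constructor
  · intro hex
    obtain ⟨z, ⟨hz0, hz⟩, hmin⟩ := exists_squareSum_minimal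
      (P := fun z : A → ℤ => (∀ a, 0 ≤ z a) ∧ D.IsFlow m z) hex
    refine ⟨squareSum z, ⟨⟨z, hz0, hz, rfl⟩, ?_⟩, ?_, ?_⟩
    · rintro s ⟨z', h0, h', rfl⟩
      exact hmin z' ⟨h0, h'⟩
    · obtain ⟨π, hπ0, hπ⟩ := D.exists_potential_of_squareSum_minimal hz (fun a => 0 < z a)
        (fun z' h' h1 h2 => hmin z' ⟨fun a => by
          have := h1 a
          by_cases h : 0 < z a
          · omega
          · exact (hz0 a).trans (h2 a h), h'⟩)
      refine ⟨π, hπ0, ?_⟩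
      rw [← hz.sum_mul_tension, squareSum, halfProd, ← Finset.sum_sub_distrib]
      refine Finset.sum_congr rfl fun a _ => ?_
      rw [floor_half_mul_ceil_half]
      obtain ⟨h1, h2⟩ := hπ a
      rcases (hz0 a).eq_or_lt with h | h
      -- With `z a = 0` the tension is at most 1, so its truncation is 0 or 1 and the rounded-down
      -- half vanishes.
      · rw [← h] at h1 ⊢
        have : max (D.tension π a) 0 / 2 = 0 := by omega
        rw [this]
        ring
      · have h3 := h2 h
        rw [max_eq_left (by omega), mul_sub_half_mul_half_eq_sq h1 h3]
    · rintro t ⟨π, -, rfl⟩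
      rw [← hz.sum_mul_tension, squareSum, halfProd, ← Finset.sum_sub_distrib]
      refine Finset.sum_le_sum fun a _ => ?_
      rw [floor_half_mul_ceil_half]
      have h1 := mul_sub_half_mul_half_le_sq (z a) (max (D.tension π a) 0)
      -- Truncating the tension can only increase `z a * Δ`, as `z a ≥ 0`.
      have h2 := mul_le_mul_of_nonneg_left (le_max_left (D.tension π a) 0) (hz0 a)
      omega
  · intro hex
    obtain ⟨z, hz, hmin⟩ := exists_squareSum_minimal (P := fun z : A → ℤ => D.IsFlow m z) hex
    refine ⟨squareSum z, ⟨⟨z, hz, rfl⟩, ?_⟩, ?_, ?_⟩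
    · rintro s ⟨z', h', rfl⟩
      exact hmin z' h'
    · obtain ⟨π, hπ0, hπ⟩ := D.exists_potential_of_squareSum_minimal hz (fun _ => True)
        (fun z' h' _ _ => hmin z' h')
      refine ⟨π, hπ0, ?_⟩
      rw [← hz.sum_mul_tension, squareSum, halfProd, ← Finset.sum_sub_distrib]
      refine Finset.sum_congr rfl fun a _ => ?_
      rw [floor_half_mul_ceil_half, mul_sub_half_mul_half_eq_sq (hπ a).1 ((hπ a).2 trivial)]
    · rintro t ⟨π, -, rfl⟩
      rw [← hz.sum_mul_tension, squareSum, halfProd, ← Finset.sum_sub_distrib]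
      refine Finset.sum_le_sum fun a _ => ?_
      rw [floor_half_mul_ceil_half]
      exact mul_sub_half_mul_half_le_sq _ _
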